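/- Theorem. Let $H$ be a separable complex Hilbert space, let $L(H)$ be the algebra of bounded operators on $H$, and let $H\otimes H$ be the Hilbert space tensor product. The ultraweak topology on $L(H)$ is the coarsest topology for which $A\mapsto \mathrm{tr}(TA)$ is continuous for every trace-class operator $T$. Let $\Phi^*:L(H\otimes H)\to L(H)$ be a quantum channel in the Heisenberg picture, i.e. a unital, completely positive, normal (ultraweakly continuous) linear map, and suppose that it is symmetric: $\Phi^*(A\otimes B)=\Phi^*(B\otimes A)$ for all $A,B\in L(H)$. Let $\Phi_0^*(A)=\Phi^*(A\otimes I)=\Phi^*(I\otimes A)$ be its marginal, with fixed-point set $\mathrm{Fix}(\Phi_0^*)=\{A\in L(H):\Phi_0^*(A)=A\}$. If $\mathcal N\subseteq \mathrm{Fix}(\Phi_0^*)$ is a unital $*$-subalgebra of $L(H)$ (containing $I$ and closed under the operator product and the adjoint), then the ultraweak closure of $\mathcal N$ is a completely atomic von Neumann algebra on $H$. That is, the closure is a von Neumann algebra $M\subseteq L(H)$, and there is a countable family $(P_i)_i$ of mutually orthogonal minimal projections of $M$ with $\sum_i P_i=I$ strongly which generates $M$ as a von Neumann algebra, $M=\{P_i\}_i''$.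 -/

import Mathlib

open scoped TensorProduct CStarAlgebra ComplexOrder InnerProductSpace

noncomputable section

namespace Broadcast

/-- The Hilbert space tensor product `H ⊗ K`: the completion of the algebraic tensor product for
the inner product with `⟪x ⊗ y, x' ⊗ y'⟫ = ⟪x, x'⟫ * ⟪y, y'⟫`. -/
abbrev HTensor (H K : Type*) [NormedAddCommGroup H] [InnerProductSpace ℂ H]
    [NormedAddCommGroup K] [InnerProductSpace ℂ K] : Type _ :=
  UniformSpace.Completion (H ⊗[ℂ] K)

/-- The tensor product `A ⊗ B` of two bounded operators, as a bounded operator on `H ⊗ K`: the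
continuous extension of `x ⊗ y ↦ A x ⊗ B y`. -/
def opTensor {H K : Type*} [NormedAddCommGroup H] [InnerProductSpace ℂ H]
    [NormedAddCommGroup K] [InnerProductSpace ℂ K] (A : H →L[ℂ] H) (B : K →L[ℂ] K) :
    HTensor H K →L[ℂ] HTensor H K :=
  (TensorProduct.mapL A B).completion

theorem opTensor_tmul {H K : Type*} [NormedAddCommGroup H] [InnerProductSpace ℂ H]
    [NormedAddCommGroup K] [InnerProductSpace ℂ K] (A : H →L[ℂ] H) (B : K →L[ℂ] K)
    (x : H) (y : K) :
    opTensor A B ((x ⊗ₜ[ℂ] y : H ⊗[ℂ] K) : HTensor H K)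
      = ((A x ⊗ₜ[ℂ] B y : H ⊗[ℂ] K) : HTensor H K) := by
  simp [opTensor]

/-- The functional `A ↦ ∑ n, ⟪x n, A (y n)⟫ = tr (T A)` on bounded operators, for
square-summable sequences `x`, `y`. Here `T = ∑ n, |y n⟩⟨x n|`, and the operators `T` of this form
are exactly the trace-class operators. -/
def traceFunctional {H : Type*} [NormedAddCommGroup H] [InnerProductSpace ℂ H]
    (p : lp (fun _ : ℕ => H) 2 × lp (fun _ : ℕ => H) 2) (A : H →L[ℂ] H) : ℂ :=
  ∑' n, ⟪p.1 n, A (p.2 n)⟫_ℂ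

/-- The series defining `traceFunctional` converges absolutely. -/
theorem summable_traceFunctional {H : Type*} [NormedAddCommGroup H] [InnerProductSpace ℂ H]
    (p : lp (fun _ : ℕ => H) 2 × lp (fun _ : ℕ => H) 2) (A : H →L[ℂ] H) :
    Summable fun n => ‖⟪p.1 n, A (p.2 n)⟫_ℂ‖ := by
  have h1 : Summable fun n => ‖p.1 n‖ ^ (2 : ℝ) := by
    simpa using (lp.memℓp p.1).summable (by norm_num)
  have h2 : Summable fun n => ‖p.2 n‖ ^ (2 : ℝ) := by
    simpa using (lp.memℓp p.2).summable (by norm_num)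
  refine Summable.of_nonneg_of_le (fun _ => norm_nonneg _) (fun n => ?_)
    ((h1.add h2).mul_left ‖A‖)
  have e1 : ‖⟪p.1 n, A (p.2 n)⟫_ℂ‖ ≤ ‖p.1 n‖ * (‖A‖ * ‖p.2 n‖) :=
    (norm_inner_le_norm _ _).trans (by gcongr; exact A.le_opNorm _)
  have e2 : ‖p.1 n‖ * ‖p.2 n‖ ≤ ‖p.1 n‖ ^ 2 + ‖p.2 n‖ ^ 2 := by
    nlinarith [sq_nonneg (‖p.1 n‖ - ‖p.2 n‖), sq_nonneg ‖p.1 n‖, sq_nonneg ‖p.2 n‖]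
  have e3 := mul_le_mul_of_nonneg_left e2 (norm_nonneg A)
  simp only [Real.rpow_ofNat]
  linarith

/-- The ultraweak (σ-weak) topology on bounded operators: the coarsest topology for which all the
functionals `A ↦ tr (T A)`, `T` trace class, are continuous. -/
abbrev ultraweakTopology (H : Type*) [NormedAddCommGroup H] [InnerProductSpace ℂ H] :
    TopologicalSpace (H →L[ℂ] H) :=
  ⨅ p : lp (fun _ : ℕ => H) 2 × lp (fun _ : ℕ => H) 2,
    TopologicalSpace.induced (traceFunctional p) inferInstance

/-- The ultraweak closure of a set of bounded operators. -/
def ultraweakClosure {H : Type*} [NormedAddCommGroup H] [InnerProductSpace ℂ H]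
    (S : Set (H →L[ℂ] H)) : Set (H →L[ℂ] H) :=
  @closure _ (ultraweakTopology H) S

/-- A quantum channel in the Heisenberg picture, `L(K) → L(H)`: a unital, completely positive and
normal (ultraweakly continuous) linear map. -/
structure Channel (K H : Type*) [NormedAddCommGroup K] [InnerProductSpace ℂ K] [CompleteSpace K]
    [NormedAddCommGroup H] [InnerProductSpace ℂ H] [CompleteSpace H] where
  toCP : (K →L[ℂ] K) →CP (H →L[ℂ] H)
  map_one : toCP 1 = 1
  normal : @Continuous _ _ (ultraweakTopology K) (ultraweakTopology H) toCP

variable {H : Type*} [NormedAddCommGroup H] [InnerProductSpace ℂ H] [CompleteSpace H]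

/-- A symmetric channel: `Φ (A ⊗ B) = Φ (B ⊗ A)` for all bounded `A`, `B`. -/
def Channel.IsSymmetric (Φ : Channel (HTensor H H) H) : Prop :=
  ∀ A B : H →L[ℂ] H, Φ.toCP (opTensor A B) = Φ.toCP (opTensor B A)

/-- The marginal `A ↦ Φ (A ⊗ 1)`. -/
def Channel.marginal (Φ : Channel (HTensor H H) H) (A : H →L[ℂ] H) : H →L[ℂ] H :=
  Φ.toCP (opTensor A 1)

/-- A discrete projection-valued measure on a countable set `ι`, given by the projections
of its points: mutually orthogonal projections that sum strongly to the identity. -/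
structure IsDiscretePVM {ι : Type*} (P : ι → H →L[ℂ] H) : Prop where
  countable : Countable ι
  isStarProjection : ∀ i, IsStarProjection (P i)
  orthogonal : ∀ i j, i ≠ j → P i * P j = 0
  hasSum : ∀ x : H, HasSum (fun i => P i x) x

/-- `P` is a minimal projection (an atom) of the von Neumann algebra `M`. -/
structure IsMinimalProjection (M : VonNeumannAlgebra H) (P : H →L[ℂ] H) : Prop where
  mem : P ∈ M
  isStarProjection : IsStarProjection P
  ne_zero : P ≠ 0
  minimal : ∀ Q ∈ M, IsStarProjection Q → Q ≤ P → Q = 0 ∨ Q = P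

/-- `M` is completely atomic: it is generated, as a von Neumann algebra, by a discrete
projection-valued measure, whose projections are atoms of `M`. The von Neumann algebra generated
by a self-adjoint set of operators is its double commutant. -/
def IsCompletelyAtomic (M : VonNeumannAlgebra H) : Prop :=
  ∃ (ι : Type) (P : ι → H →L[ℂ] H), IsDiscretePVM P ∧ (∀ i, IsMinimalProjection M (P i)) ∧
    (M : Set (H →L[ℂ] H)) = Set.centralizer (Set.centralizer (Set.range P))

end Broadcast

end

/-!
Write `Φ₀` for the marginal `X ↦ Φ (X ⊗ 1)`. For `A` in the algebra `N` of fixed points, `A` and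
`A* A` are both fixed, so `A ⊗ 1` and, by symmetry, `1 ⊗ A` lie in the multiplicative domain of
`Φ`: the Kadison–Schwarz inequality makes `Φ` a bimodule map over them
(`map_star_mul_of_map_star_mul_self`). Moving `1 ⊗ A` past `X ⊗ 1` shows that `Φ₀ X` commutes
with `N` for *every* bounded `X` (`commute_marginal`); hence `N` is commutative, and
`Φ₀ (A X) = Φ₀ (X A)` for `A` in `N` (`marginal_mul_comm`).

Fix a vector `x`. By normality the functional `X ↦ ⟪x, Φ₀ X x⟫` is `X ↦ tr (X ρ)` with a compact,
self-adjoint `ρ` (`exists_isRepresentedBy`), and the last identity says that `ρ` commutes with `N`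
(`mem_centralizer_of_isRepresentedBy`). The eigenspaces of `ρ` for nonzero eigenvalues are
finite-dimensional and invariant under the commutative `*`-algebra `N`, so they are spanned by joint
eigenvectors. Let `Q` be the projection onto the orthogonal complement of all joint eigenvectors
of `N`; then `Q ρ = 0` (`starProjection_mul_eq_zero`). As `Q` lies in the bicommutant of `N`, that
is, in its ultraweak closure (`ultraweakClosure_eq_centralizer_centralizer`), `Q` is fixed by `Φ₀`,
whence `⟪x, Q x⟫ = tr (Q ρ) = 0`. Here `x` was arbitrary, so `Q = 0`, and `H` is the orthogonal sum
of the joint eigenspaces of `N`. The bicommutant contains the projections onto them and acts on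
each as scalars, so they are its atoms and generate it (`isCompletelyAtomic_bicommutant`).
-/

noncomputable section

namespace Broadcast

/-! ### The multiplicative domain of a unital completely positive map -/

section MultiplicativeDomain

variable {A B : Type*} [CStarAlgebra A] [PartialOrder A] [StarOrderedRing A]
  [CStarAlgebra B] [PartialOrder B] [StarOrderedRing B]

theorem cstarMatrix_apply_self_nonneg {n : Type*} [Fintype n] {M : CStarMatrix n n A}
    (hM : 0 ≤ M) (i : n) : 0 ≤ M i i := by
  rw [StarOrderedRing.nonneg_iff] at hM
  induction hM using AddSubmonoid.closure_induction with
  | mem M hM =>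
    obtain ⟨C, rfl⟩ := hM
    simp only [CStarMatrix.mul_apply]
    exact Finset.sum_nonneg fun j _ => star_mul_self_nonneg (C j i)
  | zero => exact le_rfl
  | add M M' _ _ h h' => exact add_nonneg h h'

/-- `map_star` for completely positive maps, stated for abstract algebras, where the instances that
it needs are cheap to find. -/
theorem cp_map_star (φ : A →CP B) (a : A) : φ (star a) = star (φ a) :=
  map_star φ a

/-- The Kadison–Schwarz inequality. -/
theorem kadison_schwarz (φ : A →CP B) (h1 : φ 1 = 1) (a : A) :
    star (φ a) * φ a ≤ φ (star a * a) := by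
  -- conjugate the image of the positive matrix `[1, a; a*, a* a]` by the column `(-φ a, 1)`
  let R : CStarMatrix (Fin 2) (Fin 2) A := CStarMatrix.ofMatrix !![1, a; 0, 0]
  let C : CStarMatrix (Fin 2) (Fin 2) B := CStarMatrix.ofMatrix !![-φ a, 0; 1, 0]
  have h := φ.map_cstarMatrix_nonneg (star R * R) (star_mul_self_nonneg R)
  simpa [CStarMatrix.mul_apply, Fin.sum_univ_two, R, C, CStarMatrix.star_apply, h1,
    cp_map_star]
    using cstarMatrix_apply_self_nonneg (star_left_conjugate_nonneg h C) 0

theorem eq_zero_of_forall_nonneg_add_smul {D E : B} (h : ∀ t : ℝ, 0 ≤ D + t • E) : E = 0 := by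
  have key : ∀ F : B, (∀ t : ℝ, 0 ≤ D + t • F) → 0 ≤ F := by
    intro F hF
    have hlim : Filter.Tendsto (fun n : ℕ => (1 / ((n : ℝ) + 1)) • D + F) Filter.atTop
        (nhds ((0 : ℝ) • D + F)) :=
      (tendsto_one_div_add_atTop_nhds_zero_nat.smul_const D).add_const F
    rw [zero_smul, zero_add] at hlim
    refine ge_of_tendsto' hlim fun n => ?_
    have hn : (0 : ℝ) < n + 1 := by positivity
    have := smul_nonneg (le_of_lt (one_div_pos.mpr hn)) (hF (n + 1))
    rwa [smul_add, smul_smul, one_div_mul_cancel hn.ne', one_smul] at this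
  refine le_antisymm ?_ (key E h)
  rw [← neg_nonneg]
  refine key (-E) fun t => ?_
  simpa using h (-t)

/-- If `φ` is multiplicative on `a* a`, then it is multiplicative on `a* x` for every `x`: the
form `(x, y) ↦ φ (x* y) - (φ x)* (φ y)` is positive and vanishes at `(a, a)`. -/
theorem map_star_mul_of_map_star_mul_self (φ : A →CP B) (h1 : φ 1 = 1) {a : A}
    (ha : φ (star a * a) = star (φ a) * φ a) (x : A) :
    φ (star a * x) = star (φ a) * φ x := by
  have key : ∀ c : A, φ (star c * c) = star (φ c) * φ c →
      (φ (star c * x) - star (φ c) * φ x) + (φ (star x * c) - star (φ x) * φ c) = 0 := by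
    intro c hc
    refine eq_zero_of_forall_nonneg_add_smul
      (D := φ (star x * x) - star (φ x) * φ x) fun t => ?_
    have h := sub_nonneg.mpr (kadison_schwarz φ h1 (x + (t : ℂ) • c))
    convert h using 1
    rw [← Complex.coe_smul]
    simp only [star_add, star_smul, map_add, map_smul, add_mul, mul_add, smul_mul_assoc,
      mul_smul_comm, hc, Complex.star_def, Complex.conj_ofReal, smul_sub, smul_add]
    abel
  have e1 := key a ha
  -- `key` gives the vanishing of the real part; replacing `a` by `i a` gives that of the rest
  have e2 := key (Complex.I • a) (by
    simp only [star_smul, map_smul, smul_mul_assoc, mul_smul_comm, ha])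
  simp only [star_smul, map_smul, smul_mul_assoc, mul_smul_comm, Complex.star_def,
    Complex.conj_I, neg_smul, map_neg, neg_mul] at e2
  set X := φ (star a * x) - star (φ a) * φ x with hX
  set Y := φ (star x * a) - star (φ x) * φ a with hY
  have e3 : Complex.I • (Y - X) = 0 := by
    rw [← e2, hX, hY]
    simp only [smul_sub]
    abel
  have e4 : Y - X = 0 := (smul_eq_zero.mp e3).resolve_left Complex.I_ne_zero
  have e5 : (2 : ℂ) • X = 0 := by
    rw [two_smul, ← e1]
    nth_rewrite 2 [← sub_eq_zero.mp e4]
    rfl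
  exact sub_eq_zero.mp ((smul_eq_zero.mp e5).resolve_left two_ne_zero)

end MultiplicativeDomain

/-! ### Tensor products of operators -/

section OpTensor

variable {H K : Type*} [NormedAddCommGroup H] [InnerProductSpace ℂ H]
  [NormedAddCommGroup K] [InnerProductSpace ℂ K]

/-- Finite sums of elementary tensors are dense in the Hilbert space tensor product. -/
theorem dense_span_tmul :
    Dense (Submodule.span ℂ {z : HTensor H K |
      ∃ (x : H) (y : K), ((x ⊗ₜ[ℂ] y : H ⊗[ℂ] K) : HTensor H K) = z} : Set (HTensor H K)) := by
  refine (UniformSpace.Completion.denseRange_coe (α := H ⊗[ℂ] K)).mono ?_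
  rintro _ ⟨z, rfl⟩
  induction z using TensorProduct.induction_on with
  | zero => exact Submodule.zero_mem _
  | tmul x y => exact Submodule.subset_span ⟨x, y, rfl⟩
  | add a b ha hb =>
    rw [UniformSpace.Completion.coe_add]
    exact Submodule.add_mem _ ha hb

theorem clm_ext_tmul {F : Type*} [NormedAddCommGroup F] [NormedSpace ℂ F]
    {S T : HTensor H K →L[ℂ] F}
    (h : ∀ (x : H) (y : K), S ((x ⊗ₜ[ℂ] y : H ⊗[ℂ] K) : HTensor H K)
      = T ((x ⊗ₜ[ℂ] y : H ⊗[ℂ] K) : HTensor H K)) : S = T := by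
  refine ContinuousLinearMap.ext_on dense_span_tmul ?_
  rintro _ ⟨x, y, rfl⟩
  exact h x y

theorem inner_coe_tmul (x x' : H) (y y' : K) :
    ⟪((x ⊗ₜ[ℂ] y : H ⊗[ℂ] K) : HTensor H K), ((x' ⊗ₜ[ℂ] y' : H ⊗[ℂ] K) : HTensor H K)⟫_ℂ
      = ⟪x, x'⟫_ℂ * ⟪y, y'⟫_ℂ := by
  simp

theorem opTensor_mul (A A' : H →L[ℂ] H) (B B' : K →L[ℂ] K) :
    opTensor A B * opTensor A' B' = opTensor (A * A') (B * B') :=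
  clm_ext_tmul fun x y => by
    simp only [mul_apply_eq_comp, opTensor_tmul]

theorem opTensor_add_left (A A' : H →L[ℂ] H) (B : K →L[ℂ] K) :
    opTensor (A + A') B = opTensor A B + opTensor A' B :=
  clm_ext_tmul fun x y => by
    simp only [add_apply, opTensor_tmul, TensorProduct.add_tmul,
      UniformSpace.Completion.coe_add]

theorem opTensor_smul_left (c : ℂ) (A : H →L[ℂ] H) (B : K →L[ℂ] K) :
    opTensor (c • A) B = c • opTensor A B :=
  clm_ext_tmul fun x y => by
    rw [smul_apply, opTensor_tmul, opTensor_tmul, smul_apply, ← TensorProduct.smul_tmul',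
      UniformSpace.Completion.coe_smul]

theorem star_opTensor [CompleteSpace H] [CompleteSpace K] (A : H →L[ℂ] H) (B : K →L[ℂ] K) :
    star (opTensor A B) = opTensor (star A) (star B) := by
  refine clm_ext_tmul fun x y => ?_
  refine ext_inner_left ℂ fun z => ?_
  rw [ContinuousLinearMap.star_eq_adjoint, ContinuousLinearMap.adjoint_inner_right]
  revert z
  suffices h : innerSL ℂ (opTensor (star A) (star B) ((x ⊗ₜ[ℂ] y : H ⊗[ℂ] K) : HTensor H K))
      = (innerSL ℂ ((x ⊗ₜ[ℂ] y : H ⊗[ℂ] K) : HTensor H K)).comp (opTensor A B) by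
    intro z
    have := congrArg (starRingEnd ℂ) (congrArg (fun f => f z) h)
    simpa using this.symm
  refine clm_ext_tmul fun x' y' => ?_
  simp only [ContinuousLinearMap.comp_apply, innerSL_apply_apply, opTensor_tmul, inner_coe_tmul,
    ContinuousLinearMap.star_eq_adjoint, ContinuousLinearMap.adjoint_inner_left]

end OpTensor

/-! ### The fixed algebra of a symmetric channel -/

section Channel

variable {H : Type*} [NormedAddCommGroup H] [InnerProductSpace ℂ H] [CompleteSpace H]
  {Φ : Channel (HTensor H H) H} {N : StarSubalgebra ℂ (H →L[ℂ] H)}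

theorem Channel.marginal_add (Φ : Channel (HTensor H H) H) (A B : H →L[ℂ] H) :
    Φ.marginal (A + B) = Φ.marginal A + Φ.marginal B := by
  simp [Channel.marginal, opTensor_add_left]

theorem Channel.marginal_smul (Φ : Channel (HTensor H H) H) (c : ℂ) (A : H →L[ℂ] H) :
    Φ.marginal (c • A) = c • Φ.marginal A := by
  simp [Channel.marginal, opTensor_smul_left]

theorem Channel.marginal_star (Φ : Channel (HTensor H H) H) (A : H →L[ℂ] H) :
    Φ.marginal (star A) = star (Φ.marginal A) := by
  rw [Channel.marginal, Channel.marginal, ← cp_map_star, star_opTensor, star_one]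

/-- `A ⊗ 1` lies in the multiplicative domain of the channel, since `A` and `A* A` are fixed. -/
theorem map_opTensor_one_mul (hN : (N : Set (H →L[ℂ] H)) ⊆ Function.fixedPoints Φ.marginal)
    {A : H →L[ℂ] H} (hA : A ∈ N) (X : HTensor H H →L[ℂ] HTensor H H) :
    Φ.toCP (opTensor A 1 * X) = A * Φ.toCP X := by
  have fix : ∀ B ∈ N, Φ.toCP (opTensor B 1) = B := fun B hB => hN hB
  have h := map_star_mul_of_map_star_mul_self Φ.toCP Φ.map_one (a := opTensor (star A) 1)
    (by rw [star_opTensor, star_star, star_one, opTensor_mul, one_mul, fix _ (star_mem hA),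
          star_star, fix _ (mul_mem hA (star_mem hA))]) X
  rwa [star_opTensor, star_star, star_one, fix _ (star_mem hA), star_star] at h

theorem map_mul_opTensor_one (hN : (N : Set (H →L[ℂ] H)) ⊆ Function.fixedPoints Φ.marginal)
    {A : H →L[ℂ] H} (hA : A ∈ N) (X : HTensor H H →L[ℂ] HTensor H H) :
    Φ.toCP (X * opTensor A 1) = Φ.toCP X * A := by
  have h := congrArg star (map_opTensor_one_mul hN (star_mem hA) (star X))
  rwa [← cp_map_star, star_mul, star_mul, star_opTensor, star_star, star_one, star_star,
    cp_map_star, star_star] at h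

/-- Symmetry makes `1 ⊗ A` an element of the multiplicative domain as well. -/
theorem map_one_opTensor_mul (hΦ : Φ.IsSymmetric)
    (hN : (N : Set (H →L[ℂ] H)) ⊆ Function.fixedPoints Φ.marginal)
    {A : H →L[ℂ] H} (hA : A ∈ N) (X : HTensor H H →L[ℂ] HTensor H H) :
    Φ.toCP (opTensor 1 A * X) = A * Φ.toCP X := by
  have fix : ∀ B ∈ N, Φ.toCP (opTensor 1 B) = B := fun B hB => (hΦ 1 B).trans (hN hB)
  have h := map_star_mul_of_map_star_mul_self Φ.toCP Φ.map_one (a := opTensor 1 (star A))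
    (by rw [star_opTensor, star_star, star_one, opTensor_mul, one_mul, fix _ (star_mem hA),
          star_star, fix _ (mul_mem hA (star_mem hA))]) X
  rwa [star_opTensor, star_star, star_one, fix _ (star_mem hA), star_star] at h

theorem map_mul_one_opTensor (hΦ : Φ.IsSymmetric)
    (hN : (N : Set (H →L[ℂ] H)) ⊆ Function.fixedPoints Φ.marginal)
    {A : H →L[ℂ] H} (hA : A ∈ N) (X : HTensor H H →L[ℂ] HTensor H H) :
    Φ.toCP (X * opTensor 1 A) = Φ.toCP X * A := by
  have h := congrArg star (map_one_opTensor_mul hΦ hN (star_mem hA) (star X))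
  rwa [← cp_map_star, star_mul, star_mul, star_opTensor, star_star, star_one, star_star,
    cp_map_star, star_star] at h

/-- The marginal of a symmetric channel takes all of `L(H)` into the commutant of any algebra of
fixed points: move `1 ⊗ A` past `X ⊗ 1`. -/
theorem commute_marginal (hΦ : Φ.IsSymmetric)
    (hN : (N : Set (H →L[ℂ] H)) ⊆ Function.fixedPoints Φ.marginal)
    {A : H →L[ℂ] H} (hA : A ∈ N) (X : H →L[ℂ] H) : Commute A (Φ.marginal X) := by
  rw [Commute, SemiconjBy, Channel.marginal, ← map_one_opTensor_mul hΦ hN hA,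
    ← map_mul_one_opTensor hΦ hN hA, opTensor_mul, opTensor_mul, one_mul, one_mul, mul_one, mul_one]

/-- `A ⊗ 1` can be pulled out of the channel on either side, and `A` commutes with `Φ (X ⊗ 1)`. -/
theorem marginal_mul_comm (hΦ : Φ.IsSymmetric)
    (hN : (N : Set (H →L[ℂ] H)) ⊆ Function.fixedPoints Φ.marginal)
    {A : H →L[ℂ] H} (hA : A ∈ N) (X : H →L[ℂ] H) : Φ.marginal (A * X) = Φ.marginal (X * A) := by
  have h1 := map_opTensor_one_mul hN hA (opTensor X 1)
  have h2 := map_mul_opTensor_one hN hA (opTensor X 1)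
  rw [opTensor_mul, one_mul] at h1 h2
  exact h1.trans ((commute_marginal hΦ hN hA X).eq.trans h2.symm)

end Channel

/-! ### Ultraweakly continuous functionals -/

section Normal

variable {H : Type*} [NormedAddCommGroup H] [InnerProductSpace ℂ H]

theorem hasSum_of_eq {ι E : Type*} [AddCommMonoid E] [TopologicalSpace E] {f g : ι → E} {a : E}
    (hg : HasSum g a) (h : ∀ i, f i = g i) : HasSum f a :=
  (funext h : f = g) ▸ hg

theorem summable_sq_norm_lp {ι E : Type*} [NormedAddCommGroup E] (x : lp (fun _ : ι => E) 2) :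
    Summable fun i => ‖x i‖ ^ 2 := by
  simpa using (lp.memℓp x).summable (by norm_num)

theorem summable_inner_of_sq {ι F : Type*} [NormedAddCommGroup F] [InnerProductSpace ℂ F]
    {x y : ι → F} (hx : Summable fun i => ‖x i‖ ^ 2) (hy : Summable fun i => ‖y i‖ ^ 2) :
    Summable fun i => ⟪x i, y i⟫_ℂ := by
  refine Summable.of_norm_bounded (hx.add hy) fun i => (norm_inner_le_norm _ _).trans ?_
  nlinarith [sq_nonneg (‖x i‖ - ‖y i‖), sq_nonneg ‖x i‖, sq_nonneg ‖y i‖]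

theorem summable_sq_norm_apply {ι : Type*} {y : ι → H} (hy : Summable fun i => ‖y i‖ ^ 2)
    (A : H →L[ℂ] H) : Summable fun i => ‖A (y i)‖ ^ 2 := by
  refine Summable.of_nonneg_of_le (fun _ => by positivity) (fun i => ?_) (hy.mul_left (‖A‖ ^ 2))
  rw [← mul_pow]
  gcongr
  exact A.le_opNorm _

/-- Square-summable families over a countable index set, in place of sequences, still give trace
functionals. -/
theorem exists_traceFunctional_eq {ι : Type*} [Countable ι] {x y : ι → H}
    (hx : Summable fun i => ‖x i‖ ^ 2) (hy : Summable fun i => ‖y i‖ ^ 2) :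
    ∃ p : lp (fun _ : ℕ => H) 2 × lp (fun _ : ℕ => H) 2,
      ∀ A : H →L[ℂ] H, traceFunctional p A = ∑' i, ⟪x i, A (y i)⟫_ℂ := by
  obtain ⟨f, hf⟩ := Countable.exists_injective_nat ι
  have mem : ∀ z : ι → H, (Summable fun i => ‖z i‖ ^ 2) →
      Memℓp (Function.extend f z (0 : ℕ → H)) 2 := by
    intro z hz
    refine memℓp_gen ?_
    have h0 : (fun n => ‖Function.extend f z (0 : ℕ → H) n‖ ^ ((2 : ENNReal).toReal))
        = Function.extend f (fun i => ‖z i‖ ^ 2) 0 := by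
      ext n
      by_cases hn : ∃ i, f i = n
      · obtain ⟨i, rfl⟩ := hn
        simp [hf.extend_apply]
      · simp [Function.extend_apply' _ _ _ hn]
    rw [h0]
    exact (summable_extend_zero hf).mpr hz
  refine ⟨(⟨_, mem x hx⟩, ⟨_, mem y hy⟩), fun A => ?_⟩
  rw [← tsum_extend_zero hf]
  refine tsum_congr fun n => ?_
  by_cases hn : ∃ i, f i = n
  · obtain ⟨i, rfl⟩ := hn
    simp [hf.extend_apply]
  · simp [Function.extend_apply' _ _ _ hn]

theorem continuous_traceFunctional (p : lp (fun _ : ℕ => H) 2 × lp (fun _ : ℕ => H) 2) :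
    @Continuous _ _ (ultraweakTopology H) inferInstance (traceFunctional p) :=
  continuous_iInf_dom (i := p) continuous_induced_dom

theorem continuous_inner_apply (x y : H) :
    @Continuous _ _ (ultraweakTopology H) inferInstance (fun A : H →L[ℂ] H => ⟪x, A y⟫_ℂ) := by
  obtain ⟨p, hp⟩ := exists_traceFunctional_eq (ι := Unit) (x := fun _ => x) (y := fun _ => y)
    (Summable.of_finite) (Summable.of_finite)
  have : (fun A : H →L[ℂ] H => ⟪x, A y⟫_ℂ) = traceFunctional p := by
    ext A
    simp [hp]
  rw [this]
  exact continuous_traceFunctional p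

/-- `traceFunctional` as a linear functional. -/
def traceFunctionalₗ (p : lp (fun _ : ℕ => H) 2 × lp (fun _ : ℕ => H) 2) :
    (H →L[ℂ] H) →ₗ[ℂ] ℂ where
  toFun := traceFunctional p
  map_add' A B := by
    simp only [traceFunctional, add_apply, inner_add_right]
    exact (summable_traceFunctional p A).of_norm.tsum_add (summable_traceFunctional p B).of_norm
  map_smul' c A := by
    simp only [traceFunctional, smul_apply, inner_smul_right, tsum_mul_left, RingHom.id_apply,
      smul_eq_mul]

theorem isCompactOperator_rankOne (x y : H) :
    IsCompactOperator (InnerProductSpace.rankOne ℂ x y) := by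
  rw [InnerProductSpace.rankOne_def']
  exact (isCompactOperator_of_locallyCompactSpace_rng
    (ContinuousLinearMap.toSpanSingleton ℂ x)).comp_clm (innerSL ℂ y)

/-- `φ A = tr (A ρ)` for all `A`, where the trace is computed in the basis `b`, and the density
operator `ρ` is compact. -/
structure IsRepresentedBy {κ : Type*} (b : HilbertBasis κ ℂ H) (φ : (H →L[ℂ] H) → ℂ)
    (ρ : H →L[ℂ] H) : Prop where
  isCompactOperator : IsCompactOperator ρ
  hasSum : ∀ A : H →L[ℂ] H, HasSum (fun k => ⟪b k, A (ρ (b k))⟫_ℂ) (φ A)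

theorem IsRepresentedBy.apply_rankOne {κ : Type*} {b : HilbertBasis κ ℂ H}
    {φ : (H →L[ℂ] H) → ℂ} {ρ : H →L[ℂ] H} (h : IsRepresentedBy b φ ρ) (u v : H) :
    φ (InnerProductSpace.rankOne ℂ u v) = ⟪v, ρ u⟫_ℂ := by
  refine (h.hasSum _).unique ?_
  have h3 := (b.hasSum_repr u).mapL ((innerSL ℂ v).comp ρ)
  refine hasSum_of_eq h3 fun k => ?_
  simp [HilbertBasis.repr_apply_apply, mul_comm]

theorem IsRepresentedBy.apply_eq_zero {κ : Type*} {b : HilbertBasis κ ℂ H}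
    {φ : (H →L[ℂ] H) → ℂ} {ρ : H →L[ℂ] H} (h : IsRepresentedBy b φ ρ) {A : H →L[ℂ] H}
    (hA : A * ρ = 0) : φ A = 0 := by
  refine (h.hasSum A).unique ?_
  have : ∀ x, A (ρ x) = 0 := fun x => by rw [← mul_apply_eq_comp, hA]; rfl
  simp [this, hasSum_zero]

/-- Parseval's identity. -/
theorem hasSum_sq_norm_inner {κ : Type*} (b : HilbertBasis κ ℂ H) (x : H) :
    HasSum (fun k => ‖⟪b k, x⟫_ℂ‖ ^ 2) (‖x‖ ^ 2) := by
  have h := b.hasSum_inner_mul_inner x x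
  have h2 : HasSum (fun k => ((‖⟪b k, x⟫_ℂ‖ ^ 2 : ℝ) : ℂ)) ((‖x‖ ^ 2 : ℝ) : ℂ) := by
    rw [inner_self_eq_norm_sq_to_K] at h
    push_cast
    refine hasSum_of_eq h fun k => ?_
    rw [← inner_conj_symm x (b k), RCLike.conj_mul]
    rfl
  exact_mod_cast h2

theorem summable_sq_norm_inner {κ : Type*} (b : HilbertBasis κ ℂ H) {ι : Type*} {y : ι → H}
    (hy : Summable fun i => ‖y i‖ ^ 2) :
    Summable fun q : ι × κ => ‖⟪b q.2, y q.1⟫_ℂ‖ ^ 2 := by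
  rw [summable_prod_of_nonneg fun _ => by positivity]
  refine ⟨fun i => (hasSum_sq_norm_inner b (y i)).summable, ?_⟩
  simpa only [(hasSum_sq_norm_inner b (y _)).tsum_eq] using hy

variable [CompleteSpace H]

/-- The trace functional of `(x, y)` is represented by `ρ = ∑ n, |y n⟩⟨x n|`, a norm-convergent sum
of operators of rank one. -/
theorem exists_isRepresentedBy_traceFunctional {κ : Type*} (b : HilbertBasis κ ℂ H)
    (p : lp (fun _ : ℕ => H) 2 × lp (fun _ : ℕ => H) 2) :
    ∃ ρ, IsRepresentedBy b (traceFunctional p) ρ := by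
  have hx := summable_sq_norm_lp p.1
  have hy := summable_sq_norm_lp p.2
  have hs : Summable fun n => InnerProductSpace.rankOne ℂ (p.2 n) (p.1 n) := by
    refine Summable.of_norm_bounded (hx.add hy) fun n => ?_
    rw [InnerProductSpace.norm_rankOne]
    nlinarith [sq_nonneg (‖p.1 n‖ - ‖p.2 n‖), sq_nonneg ‖p.1 n‖, sq_nonneg ‖p.2 n‖]
  refine ⟨∑' n, InnerProductSpace.rankOne ℂ (p.2 n) (p.1 n), ?_, fun A => ?_⟩
  · refine isCompactOperator_of_tendsto hs.hasSum (Filter.Eventually.of_forall fun s => ?_)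
    exact Submodule.sum_mem (compactOperator (RingHom.id ℂ) H H)
      fun n _ => isCompactOperator_rankOne _ _
  · have hf : Summable fun q : ℕ × κ => ⟪p.1 q.1, b q.2⟫_ℂ * ⟪b q.2, A (p.2 q.1)⟫_ℂ := by
      have := summable_inner_of_sq (summable_sq_norm_inner b hx)
        (summable_sq_norm_inner b (summable_sq_norm_apply hy A))
      simpa only [RCLike.inner_apply, inner_conj_symm, mul_comm] using this
    have h1 : HasSum (fun q : ℕ × κ => ⟪p.1 q.1, b q.2⟫_ℂ * ⟪b q.2, A (p.2 q.1)⟫_ℂ)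
        (traceFunctional p A) := by
      have h0 : traceFunctional p A
          = ∑' q : ℕ × κ, ⟪p.1 q.1, b q.2⟫_ℂ * ⟪b q.2, A (p.2 q.1)⟫_ℂ := by
        rw [hf.tsum_prod]
        exact tsum_congr fun n => (b.tsum_inner_mul_inner _ _).symm
      rw [h0]
      exact hf.hasSum
    have h2 := (Equiv.prodComm κ ℕ).hasSum_iff.mpr h1
    refine h2.prod_fiberwise fun k => ?_
    have h3 := (hs.hasSum.mapL (ContinuousLinearMap.apply ℂ H (b k))).mapL
      ((innerSL ℂ (b k)).comp A)
    refine hasSum_of_eq h3 fun n => ?_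
    simp

/-- An ultraweakly continuous functional is a linear combination of trace functionals. -/
theorem exists_isRepresentedBy {κ : Type*} (b : HilbertBasis κ ℂ H) (φ : (H →L[ℂ] H) →ₗ[ℂ] ℂ)
    (hφ : @Continuous _ _ (ultraweakTopology H) inferInstance φ) :
    ∃ ρ, IsRepresentedBy b φ ρ := by
  have h : φ ∈ Submodule.span ℂ (Set.range (traceFunctionalₗ (H := H))) :=
    (LinearMap.mem_span_iff_continuous φ).mpr hφ
  clear hφ
  induction h using Submodule.span_induction with
  | mem φ h =>
    obtain ⟨p, rfl⟩ := h
    exact exists_isRepresentedBy_traceFunctional b p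
  | zero => exact ⟨0, isCompactOperator_zero, fun A => by simp [hasSum_zero]⟩
  | add φ ψ _ _ h h' =>
    obtain ⟨ρ, h⟩ := h
    obtain ⟨σ, h'⟩ := h'
    refine ⟨ρ + σ, h.1.add h'.1, fun A => ?_⟩
    simpa [inner_add_right] using (h.2 A).add (h'.2 A)
  | smul c φ _ h =>
    obtain ⟨ρ, h⟩ := h
    refine ⟨c • ρ, h.1.smul c, fun A => ?_⟩
    simpa [inner_smul_right] using (h.2 A).mul_left c

end Normal

/-! ### Ultraweak continuity of `X ↦ X ⊗ 1` -/

section Slice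

variable {H : Type*} [NormedAddCommGroup H] [InnerProductSpace ℂ H]

theorem Orthonormal.countable [TopologicalSpace.SeparableSpace H] {ι : Type*} {v : ι → H}
    (hv : Orthonormal ℂ v) : Countable ι := by
  refine Pairwise.countable_of_isOpen_disjoint (s := fun i => Metric.ball (v i) (1 / 2))
    (fun i j hij => ?_) (fun _ => Metric.isOpen_ball) fun i => ⟨v i, by simp⟩
  -- the vectors have mutual distance `√2 > 1`
  refine Metric.ball_disjoint_ball ?_
  have h : ‖v i - v j‖ ^ 2 = 2 := by
    rw [@norm_sub_sq ℂ, hv.1 i, hv.1 j, hv.2 hij]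
    norm_num
  rw [dist_eq_norm]
  nlinarith [norm_nonneg (v i - v j)]

/-- The isometry `h ↦ h ⊗ e` for a unit vector `e`. -/
def sliceIsometry {e : H} (he : ‖e‖ = 1) : H →ₗᵢ[ℂ] HTensor H H where
  toFun h := ((h ⊗ₜ[ℂ] e : H ⊗[ℂ] H) : HTensor H H)
  map_add' h h' := by rw [TensorProduct.add_tmul, UniformSpace.Completion.coe_add]
  map_smul' c h := by
    rw [← TensorProduct.smul_tmul', UniformSpace.Completion.coe_smul]; rfl
  norm_map' h := by
    simp [he]

variable [CompleteSpace H]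

/-- `H ⊗ H` is the Hilbert sum of the slices `H ⊗ b k`, for an orthonormal basis `b`. -/
theorem isHilbertSum_slice {κ : Type*} (b : HilbertBasis κ ℂ H) :
    IsHilbertSum ℂ (fun _ : κ => H) fun k => sliceIsometry (b.orthonormal.1 k) := by
  refine IsHilbertSum.mk (fun i j hij v w => ?_) fun z _ => ?_
  · change ⟪((v ⊗ₜ[ℂ] b i : H ⊗[ℂ] H) : HTensor H H),
      ((w ⊗ₜ[ℂ] b j : H ⊗[ℂ] H) : HTensor H H)⟫_ℂ = 0
    rw [inner_coe_tmul, b.orthonormal.2 hij, mul_zero]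
  · set S := ⨆ k, LinearMap.range (sliceIsometry (b.orthonormal.1 k)).toLinearMap with hS
    have h1 : Submodule.span ℂ {z : HTensor H H |
        ∃ (x y : H), ((x ⊗ₜ[ℂ] y : H ⊗[ℂ] H) : HTensor H H) = z} ≤ S.topologicalClosure := by
      rw [Submodule.span_le]
      rintro _ ⟨x, y, rfl⟩
      have h2 := ((b.hasSum_repr y).mapL (TensorProduct.mkL ℂ H H x)).mapL
        (UniformSpace.Completion.toComplL (𝕜 := ℂ) (E := H ⊗[ℂ] H))
      refine S.isClosed_topologicalClosure.mem_of_tendsto h2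
        (Filter.Eventually.of_forall fun s => ?_)
      refine Submodule.sum_mem _ fun k _ => S.le_topologicalClosure ?_
      rw [map_smul, map_smul]
      exact Submodule.smul_mem _ _ (Submodule.mem_iSup_of_mem k ⟨x, rfl⟩)
    exact Submodule.topologicalClosure_minimal _ h1 S.isClosed_topologicalClosure
      (by
        rw [← SetLike.mem_coe, Submodule.topologicalClosure_coe, dense_span_tmul.closure_eq]
        trivial)

/-- Over an orthonormal basis of the second factor, `X ⊗ 1` is the direct sum of copies of `X`. -/
theorem hasSum_inner_opTensor_one {κ : Type*} (b : HilbertBasis κ ℂ H) (z w : HTensor H H)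
    (X : H →L[ℂ] H) :
    HasSum (fun k => ⟪(isHilbertSum_slice b).linearIsometryEquiv z k,
      X ((isHilbertSum_slice b).linearIsometryEquiv w k)⟫_ℂ) ⟪z, opTensor X 1 w⟫_ℂ := by
  classical
  set W := (isHilbertSum_slice b).linearIsometryEquiv with hW
  have h1 := (isHilbertSum_slice b).hasSum_linearIsometryEquiv_symm (W w)
  rw [← hW, W.symm_apply_apply] at h1
  have h2 := h1.mapL ((innerSL ℂ z).comp (opTensor X 1))
  refine hasSum_of_eq h2 fun k => ?_
  have h3 : opTensor X 1 (sliceIsometry (b.orthonormal.1 k) (W w k))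
      = sliceIsometry (b.orthonormal.1 k) (X (W w k)) := opTensor_tmul _ _ _ _
  have h4 := (isHilbertSum_slice b).linearIsometryEquiv_symm_apply_single (X (W w k)) (i := k)
  rw [ContinuousLinearMap.comp_apply, h3, ← h4, innerSL_apply_apply, ← hW,
    ← W.inner_map_map, W.apply_symm_apply, lp.inner_single_right]

theorem continuous_opTensor_one [TopologicalSpace.SeparableSpace H] :
    @Continuous _ _ (ultraweakTopology H) (ultraweakTopology (HTensor H H))
      (fun X : H →L[ℂ] H => opTensor X 1) := by
  obtain ⟨κ, b, hb⟩ := exists_hilbertBasis ℂ H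
  have hκ : Countable κ := Orthonormal.countable b.orthonormal
  refine continuous_iInf_rng.mpr fun p => continuous_induced_rng.mpr ?_
  set W := (isHilbertSum_slice b).linearIsometryEquiv with hW
  have hsq : ∀ z : lp (fun _ : ℕ => HTensor H H) 2,
      Summable fun q : ℕ × κ => ‖W (z q.1) q.2‖ ^ 2 := by
    intro z
    rw [summable_prod_of_nonneg fun _ => by positivity]
    refine ⟨fun n => summable_sq_norm_lp (W (z n)), ?_⟩
    have h : ∀ n, ∑' k, ‖W (z n) k‖ ^ 2 = ‖z n‖ ^ 2 := by
      intro n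
      have := lp.norm_rpow_eq_tsum (p := 2) (by norm_num) (W (z n))
      simp only [ENNReal.toReal_ofNat, Real.rpow_ofNat, LinearIsometryEquiv.norm_map] at this
      exact this.symm
    simp only [h]
    exact summable_sq_norm_lp z
  obtain ⟨q, hq⟩ := exists_traceFunctional_eq (hsq p.1) (hsq p.2)
  have : (traceFunctional p ∘ fun X : H →L[ℂ] H => opTensor X 1) = traceFunctional q := by
    ext X
    have hs := summable_inner_of_sq (hsq p.1) (summable_sq_norm_apply (hsq p.2) X)
    rw [hq, hs.tsum_prod]
    exact tsum_congr fun n => (hasSum_inner_opTensor_one b _ _ X).tsum_eq.symm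
  rw [this]
  exact continuous_traceFunctional q

end Slice

/-! ### The von Neumann density theorem -/

section Density

variable {H : Type*} [NormedAddCommGroup H] [InnerProductSpace ℂ H]

/-- The amplification `A ⊕ A ⊕ ⋯` of a bounded operator to the Hilbert sum of copies of `H`. -/
def amplification (ι : Type*) (A : H →L[ℂ] H) :
    lp (fun _ : ι => H) 2 →L[ℂ] lp (fun _ : ι => H) 2 :=
  lp.mapCLM 2 (fun _ => A) (norm_nonneg A) fun _ => le_rfl

theorem amplification_apply {ι : Type*} (A : H →L[ℂ] H) (z : lp (fun _ : ι => H) 2) (i : ι) :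
    amplification ι A z i = A (z i) := rfl

theorem amplification_single {ι : Type*} [DecidableEq ι] (A : H →L[ℂ] H) (j : ι) (h : H) :
    amplification ι A (lp.single 2 j h) = lp.single 2 j (A h) := by
  ext i
  rw [amplification_apply]
  by_cases hij : i = j
  · subst hij; simp
  · simp [hij]

variable [CompleteSpace H]

/-- An operator commutes with the projection onto a subspace that it reduces. -/
theorem commute_starProjection {A : H →L[ℂ] H} {K : Submodule ℂ H} [K.HasOrthogonalProjection]
    (h : ∀ x ∈ K, A x ∈ K) (h' : ∀ x ∈ K, star A x ∈ K) : Commute A K.starProjection := by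
  refine ContinuousLinearMap.ext fun z => ?_
  rw [mul_apply_eq_comp, mul_apply_eq_comp]
  symm
  refine Submodule.eq_starProjection_of_mem_orthogonal (h _ (K.starProjection_apply_mem z)) ?_
  rw [← map_sub, Submodule.mem_orthogonal]
  intro u hu
  rw [← ContinuousLinearMap.adjoint_inner_left]
  exact (K.sub_starProjection_mem_orthogonal z) _ (h' u hu)

theorem star_amplification {ι : Type*} (A : H →L[ℂ] H) :
    star (amplification ι A) = amplification ι (star A) := by
  symm
  rw [ContinuousLinearMap.star_eq_adjoint (amplification ι A), ContinuousLinearMap.eq_adjoint_iff]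
  intro x y
  simp only [lp.inner_eq_tsum, amplification_apply, ContinuousLinearMap.star_eq_adjoint,
    ContinuousLinearMap.adjoint_inner_left]

/-- The approximation step of the density theorem: the closed cyclic subspace generated by `y`
under the amplification of `N` is invariant under the amplification of the bicommutant. -/
theorem amplification_mem_closure {ι : Type*} (N : StarSubalgebra ℂ (H →L[ℂ] H))
    (y : lp (fun _ : ι => H) 2) {B : H →L[ℂ] H}
    (hB : B ∈ Set.centralizer (Set.centralizer (N : Set (H →L[ℂ] H)))) :
    amplification ι B y ∈ closure ((fun A => amplification ι A y) '' (N : Set (H →L[ℂ] H))) := by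
  classical
  let L : (H →L[ℂ] H) →ₗ[ℂ] lp (fun _ : ι => H) 2 :=
    { toFun := fun A => amplification ι A y
      map_add' := fun A A' => by ext i; rfl
      map_smul' := fun c A => by ext i; rfl }
  let K := (N.toSubalgebra.toSubmodule.map L).topologicalClosure
  have hK : (K : Set (lp (fun _ : ι => H) 2))
      = closure ((fun A => amplification ι A y) '' (N : Set (H →L[ℂ] H))) := rfl
  have : CompleteSpace K := Submodule.topologicalClosure.completeSpace _
  rw [← hK]
  have hinv : ∀ A ∈ N, ∀ x ∈ K, amplification ι A x ∈ K := by
    intro A hA x hx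
    refine map_mem_closure (amplification ι A).continuous hx ?_
    rintro _ ⟨C, hC, rfl⟩
    exact ⟨A * C, N.mul_mem hA hC, rfl⟩
  have hcomm : ∀ A ∈ N, Commute (amplification ι A) K.starProjection := fun A hA =>
    commute_starProjection (hinv A hA) (by
      rw [star_amplification]; exact hinv _ (star_mem hA))
  -- the matrix entries of the projection commute with `N`, hence with `B`
  have hentry : ∀ (j : ι) (h : H), amplification ι B (K.starProjection (lp.single 2 j h))
      = K.starProjection (amplification ι B (lp.single 2 j h)) := by
    intro j h
    ext i
    let T : H →L[ℂ] H := (lp.evalCLM ℂ (fun _ : ι => H) (p := 2) i).comp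
      (K.starProjection.comp (lp.singleContinuousLinearMap ℂ (fun _ : ι => H) 2 j))
    have hT : ∀ h, T h = K.starProjection (lp.single 2 j h) i := fun h => rfl
    have hTN : T ∈ Set.centralizer (N : Set (H →L[ℂ] H)) := by
      intro A hA
      refine ContinuousLinearMap.ext fun h => ?_
      rw [mul_apply_eq_comp, mul_apply_eq_comp, hT, hT, ← amplification_single,
        ← amplification_apply, ← mul_apply_eq_comp, (hcomm A hA).eq, mul_apply_eq_comp]
    have := congrArg (fun S => S h) (hB T hTN)
    simp only [mul_apply_eq_comp, hT] at this
    rw [amplification_apply, ← this, amplification_single]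
  have hcommB : ∀ z, amplification ι B (K.starProjection z)
      = K.starProjection (amplification ι B z) := by
    intro z
    have hz := lp.hasSum_single (p := 2) (by norm_num) z
    have h1 := (hz.mapL K.starProjection).mapL (amplification ι B)
    have h2 := (hz.mapL (amplification ι B)).mapL K.starProjection
    exact h1.unique (hasSum_of_eq h2 fun j => hentry j _)
  have hy : y ∈ K := subset_closure ⟨1, one_mem N, by ext i; rfl⟩
  rw [← Submodule.starProjection_eq_self_iff.mpr hy, hcommB]
  exact K.starProjection_apply_mem _

theorem isClosed_centralizer (S : Set (H →L[ℂ] H)) :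
    @IsClosed _ (ultraweakTopology H) (Set.centralizer S) := by
  let _ := ultraweakTopology H
  have : Set.centralizer S
      = ⋂ T ∈ S, ⋂ x : H, ⋂ y : H, {B : H →L[ℂ] H | ⟪star T x, B y⟫_ℂ = ⟪x, B (T y)⟫_ℂ} := by
    ext B
    simp only [Set.mem_centralizer_iff, Set.mem_iInter, Set.mem_ofPred_eq,
      ContinuousLinearMap.star_eq_adjoint, ContinuousLinearMap.adjoint_inner_left]
    refine forall₂_congr fun T hT => ⟨fun h x y => ?_, fun h => ?_⟩
    · rw [← mul_apply_eq_comp, h, mul_apply_eq_comp]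
    · exact ContinuousLinearMap.ext fun y => ext_inner_left ℂ fun x => h x y
  rw [this]
  exact isClosed_biInter fun T _ => isClosed_iInter fun x => isClosed_iInter fun y =>
    isClosed_eq (continuous_inner_apply _ _) (continuous_inner_apply _ _)

/-- The von Neumann density theorem. -/
theorem ultraweakClosure_eq_centralizer_centralizer (N : StarSubalgebra ℂ (H →L[ℂ] H)) :
    ultraweakClosure (N : Set (H →L[ℂ] H))
      = Set.centralizer (Set.centralizer (N : Set (H →L[ℂ] H))) := by
  refine Set.Subset.antisymm ?_ fun B hB => ?_
  · let _ := ultraweakTopology H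
    exact closure_minimal Set.subset_centralizer_centralizer (isClosed_centralizer _)
  have htop : ultraweakTopology H = TopologicalSpace.induced
      (fun (A : H →L[ℂ] H) (p : lp (fun _ : ℕ => H) 2 × lp (fun _ : ℕ => H) 2) =>
        traceFunctional p A) inferInstance :=
    (induced_to_pi _).symm
  rw [ultraweakClosure, htop, closure_induced, mem_closure_iff]
  intro o ho hBo
  obtain ⟨I, u, hu, hI⟩ := isOpen_pi_iff.mp ho _ hBo
  -- the finitely many second sequences, joined to one vector of an amplification
  have hmem : ∀ z : I × ℕ → H, (∀ q, Summable fun n => ‖z (q, n)‖ ^ 2) → Memℓp z 2 := by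
    intro z hz
    refine memℓp_gen ?_
    simp only [ENNReal.toReal_ofNat, Real.rpow_ofNat]
    rw [summable_prod_of_nonneg fun _ => by positivity]
    exact ⟨hz, Summable.of_finite⟩
  let y : lp (fun _ : I × ℕ => H) 2 :=
    ⟨fun q => q.1.1.2 q.2, hmem _ fun q => summable_sq_norm_lp q.1.2⟩
  have hrep : ∀ p ∈ I, ∃ x : lp (fun _ : I × ℕ => H) 2, ∀ A : H →L[ℂ] H,
      ⟪x, amplification (I × ℕ) A y⟫_ℂ = traceFunctional p A := by
    classical
    intro p hp
    have hx : Memℓp (fun q : I × ℕ => if q.1 = ⟨p, hp⟩ then p.1 q.2 else 0) 2 := by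
      refine hmem _ fun q => ?_
      by_cases hq : q = ⟨p, hp⟩
      · simpa [hq] using summable_sq_norm_lp p.1
      · simp [hq, summable_zero]
    let x : lp (fun _ : I × ℕ => H) 2 := ⟨_, hx⟩
    refine ⟨x, fun A => ?_⟩
    have hs : Summable fun q : I × ℕ => ⟪x q, amplification (I × ℕ) A y q⟫_ℂ :=
      lp.summable_inner x (amplification (I × ℕ) A y)
    rw [lp.inner_eq_tsum, hs.tsum_prod, tsum_eq_single (⟨p, hp⟩ : I)]
    · exact tsum_congr fun n => by simp [x, y, amplification_apply]
    · intro q hq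
      simp [x, hq]
  obtain ⟨z, hz, hlim⟩ := mem_closure_iff_seq_limit.mp (amplification_mem_closure N y hB)
  choose A hAN hA using hz
  have hev : ∀ p ∈ I, ∀ᶠ n in Filter.atTop, traceFunctional p (A n) ∈ u p := by
    intro p hp
    obtain ⟨x, hx⟩ := hrep p hp
    have h1 := ((innerSL ℂ x).continuous.tendsto _).comp hlim
    have h2 : Filter.Tendsto (fun n => traceFunctional p (A n)) Filter.atTop
        (nhds (traceFunctional p B)) := by
      rw [← hx]
      refine h1.congr fun n => ?_
      rw [← hx, Function.comp_apply, ← hA n]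
      rfl
    exact h2 ((hu p hp).1.mem_nhds (hu p hp).2)
  obtain ⟨n, hn⟩ := ((Filter.eventually_all_finset I).mpr hev).exists
  exact ⟨_, hI fun p hp => hn p hp, A n, hAN n, rfl⟩

end Density

/-! ### Joint eigenspaces of a commutative algebra of operators -/

section Joint

variable {H : Type*} [NormedAddCommGroup H] [InnerProductSpace ℂ H] [CompleteSpace H]
  {N : StarSubalgebra ℂ (H →L[ℂ] H)}

/-- The vectors on which every `A` in `N` acts as the scalar `χ A`. -/
def jointEigenspace (N : StarSubalgebra ℂ (H →L[ℂ] H)) (χ : N → ℂ) : Submodule ℂ H :=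
  ⨅ A : N, Module.End.eigenspace (A.1 : H →ₗ[ℂ] H) (χ A)

theorem mem_jointEigenspace {χ : N → ℂ} {x : H} :
    x ∈ jointEigenspace N χ ↔ ∀ A : N, A.1 x = χ A • x := by
  simp [jointEigenspace]

theorem isClosed_jointEigenspace (χ : N → ℂ) : IsClosed (jointEigenspace N χ : Set H) := by
  have : (jointEigenspace N χ : Set H) = ⋂ A : N, {x | A.1 x = χ A • x} := by
    ext x
    simp [mem_jointEigenspace]
  rw [this]
  exact isClosed_iInter fun A => isClosed_eq A.1.continuous (continuous_const_smul _)

instance (χ : N → ℂ) : CompleteSpace (jointEigenspace N χ) :=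
  (isClosed_jointEigenspace χ).completeSpace_coe

theorem apply_mem_jointEigenspace {χ : N → ℂ} {T : H →L[ℂ] H}
    (hT : T ∈ Set.centralizer (N : Set (H →L[ℂ] H))) {x : H} (hx : x ∈ jointEigenspace N χ) :
    T x ∈ jointEigenspace N χ := by
  rw [mem_jointEigenspace] at hx ⊢
  intro A
  rw [← mul_apply_eq_comp, hT A.1 A.2, mul_apply_eq_comp, hx, map_smul]

theorem star_apply_of_mem_jointEigenspace {χ : N → ℂ} {x : H} (hx : x ∈ jointEigenspace N χ)
    (A : N) : star A.1 x = starRingEnd ℂ (χ A) • x := by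
  by_cases h0 : x = 0
  · simp [h0]
  have h1 : star A.1 x = χ (star A) • x := mem_jointEigenspace.mp hx (star A)
  have h2 : ⟪star A.1 x, x⟫_ℂ = ⟪x, A.1 x⟫_ℂ := by
    rw [ContinuousLinearMap.star_eq_adjoint, ContinuousLinearMap.adjoint_inner_left]
  rw [h1, mem_jointEigenspace.mp hx A, inner_smul_left, inner_smul_right] at h2
  rw [h1, ← mul_right_cancel₀ (inner_self_ne_zero.mpr h0) h2, Complex.conj_conj]

theorem inner_eq_zero_of_mem_jointEigenspace {χ χ' : N → ℂ} (h : χ ≠ χ') {x y : H}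
    (hx : x ∈ jointEigenspace N χ) (hy : y ∈ jointEigenspace N χ') : ⟪x, y⟫_ℂ = 0 := by
  obtain ⟨A, hA⟩ := Function.ne_iff.mp h
  have h2 : ⟪star A.1 x, y⟫_ℂ = ⟪x, A.1 y⟫_ℂ := by
    rw [ContinuousLinearMap.star_eq_adjoint, ContinuousLinearMap.adjoint_inner_left]
  rw [star_apply_of_mem_jointEigenspace hx, mem_jointEigenspace.mp hy A, inner_smul_left,
    inner_smul_right, Complex.conj_conj] at h2
  by_contra h3
  exact hA (mul_right_cancel₀ h3 h2)

theorem star_mem_centralizer {T : H →L[ℂ] H}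
    (hT : T ∈ Set.centralizer (N : Set (H →L[ℂ] H))) :
    star T ∈ Set.centralizer (N : Set (H →L[ℂ] H)) := by
  intro A hA
  have := congrArg star (hT _ (star_mem hA))
  rw [star_mul, star_mul, star_star] at this
  exact this.symm

theorem starProjection_mem_centralizer_centralizer {K : Submodule ℂ H}
    [K.HasOrthogonalProjection]
    (h : ∀ T ∈ Set.centralizer (N : Set (H →L[ℂ] H)), ∀ x ∈ K, T x ∈ K) :
    K.starProjection ∈ Set.centralizer (Set.centralizer (N : Set (H →L[ℂ] H))) :=
  fun T hT => commute_starProjection (h T hT) (h _ (star_mem_centralizer hT))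

/-- Commuting operators have a joint eigenvector in every nonzero finite-dimensional invariant
subspace. -/
theorem exists_joint_eigenvector
    (hN : ∀ A ∈ N, ∀ B ∈ N, A * B = B * A) (W : Submodule ℂ H) [FiniteDimensional ℂ W]
    (hW : W ≠ ⊥) (hinv : ∀ A ∈ N, ∀ x ∈ W, A x ∈ W) :
    ∃ χ, ∃ x ∈ W, x ≠ 0 ∧ x ∈ jointEigenspace N χ := by
  induction hd : Module.finrank ℂ W using Nat.strong_induction_on generalizing W with
  | _ d ih =>
  by_cases hs : ∀ A : N, ∃ c : ℂ, ∀ x ∈ W, A.1 x = c • x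
  · choose χ hχ using hs
    obtain ⟨x, hx, hx0⟩ := Submodule.exists_mem_ne_zero_of_ne_bot hW
    exact ⟨χ, x, hx, hx0, mem_jointEigenspace.mpr fun A => hχ A x hx⟩
  push Not at hs
  obtain ⟨A, hA⟩ := hs
  -- an operator that is not scalar on `W` has a proper eigenspace there, invariant under `N`
  have : Nontrivial W := (Submodule.nontrivial_iff_ne_bot).mpr hW
  obtain ⟨μ, hμ⟩ := Module.End.exists_eigenvalue
    ((A.1 : H →ₗ[ℂ] H).restrict (p := W) (q := W) (hinv A.1 A.2))
  obtain ⟨⟨w, hwW⟩, hw, hw0⟩ := hμ.exists_hasEigenvector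
  have hw' : A.1 w = μ • w := congrArg Subtype.val (Module.End.mem_eigenspace_iff.mp hw)
  let W' : Submodule ℂ H := W ⊓ Module.End.eigenspace (A.1 : H →ₗ[ℂ] H) μ
  have hmem : ∀ x, x ∈ W' ↔ x ∈ W ∧ A.1 x = μ • x := fun x => by
    simp [W']
  have hlt : W' < W := by
    refine lt_of_le_of_ne inf_le_left fun he => ?_
    obtain ⟨x, hx, hx'⟩ := hA μ
    exact hx' ((hmem x).mp (he ▸ hx)).2
  have : FiniteDimensional ℂ W' := Submodule.finiteDimensional_of_le hlt.le
  obtain ⟨χ, x, hx, h⟩ := ih _ (hd ▸ Submodule.finrank_lt_finrank_of_lt hlt) W'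
    ((Submodule.ne_bot_iff _).mpr ⟨w, (hmem w).mpr ⟨hwW, hw'⟩, fun h => hw0 (Subtype.ext h)⟩)
    (fun B hB x hx => by
      rw [hmem] at hx ⊢
      refine ⟨hinv B hB x hx.1, ?_⟩
      rw [← mul_apply_eq_comp, hN A.1 A.2 B hB, mul_apply_eq_comp, hx.2, map_smul]) rfl
  exact ⟨χ, x, hlt.le hx, h⟩

/-- The closed linear span of the joint eigenvectors of `N`. -/
def eigenSpan (N : StarSubalgebra ℂ (H →L[ℂ] H)) : Submodule ℂ H :=
  (⨆ χ, jointEigenspace N χ).topologicalClosure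

instance : CompleteSpace (eigenSpan N) := Submodule.topologicalClosure.completeSpace _

theorem jointEigenspace_le_eigenSpan (χ : N → ℂ) : jointEigenspace N χ ≤ eigenSpan N :=
  (le_iSup _ χ).trans (Submodule.le_topologicalClosure _)

theorem apply_mem_eigenSpan {T : H →L[ℂ] H}
    (hT : T ∈ Set.centralizer (N : Set (H →L[ℂ] H))) {x : H} (hx : x ∈ eigenSpan N) :
    T x ∈ eigenSpan N := by
  have h : (⨆ χ, jointEigenspace N χ) ≤ (eigenSpan N).comap (T : H →ₗ[ℂ] H) :=
    iSup_le fun χ y hy => jointEigenspace_le_eigenSpan χ (apply_mem_jointEigenspace hT hy)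
  exact Submodule.topologicalClosure_minimal _ h
    ((Submodule.isClosed_topologicalClosure _).preimage T.continuous) hx

theorem starProjection_eigenSpan_orthogonal_mem :
    (eigenSpan N)ᗮ.starProjection
      ∈ Set.centralizer (Set.centralizer (N : Set (H →L[ℂ] H))) := by
  refine starProjection_mem_centralizer_centralizer fun T hT x hx => ?_
  rw [Submodule.mem_orthogonal] at hx ⊢
  intro u hu
  rw [← ContinuousLinearMap.adjoint_inner_left]
  exact hx _ (apply_mem_eigenSpan (star_mem_centralizer hT) hu)

/-- A compact self-adjoint operator in the commutant of `N` lives on the span of the joint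
eigenvectors: otherwise the finite-dimensional eigenspaces of its part on the complement would
contain another one. -/
theorem starProjection_mul_eq_zero (hN : ∀ A ∈ N, ∀ B ∈ N, A * B = B * A) {ρ : H →L[ℂ] H}
    (hc : IsCompactOperator ρ) (hsa : IsSelfAdjoint ρ)
    (hρ : ρ ∈ Set.centralizer (N : Set (H →L[ℂ] H))) :
    (eigenSpan N)ᗮ.starProjection * ρ = 0 := by
  set Q := (eigenSpan N)ᗮ.starProjection with hQ
  have hQN : Q ∈ Set.centralizer (Set.centralizer (N : Set (H →L[ℂ] H))) :=
    starProjection_eigenSpan_orthogonal_mem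
  have hQsa : IsSelfAdjoint Q := isStarProjection_starProjection.isSelfAdjoint
  have hSsa : IsSelfAdjoint (Q * ρ) := by
    rw [IsSelfAdjoint, star_mul, hsa.star_eq, hQsa.star_eq, hQN ρ hρ]
  have hSc : IsCompactOperator (Q * ρ) := hc.clm_comp Q
  have hSN : ∀ A ∈ N, A * (Q * ρ) = Q * ρ * A := fun A hA => by
    have hA' : A ∈ Set.centralizer (N : Set (H →L[ℂ] H)) := fun B hB => hN B hB A hA
    rw [← mul_assoc, hQN A hA', mul_assoc, hρ A hA, mul_assoc]
  refine (ContinuousLinearMap.eq_zero_of_forall_hasEigenvalue_eq_zero hSc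
    hSsa.isSymmetric).mp fun μ hμ => ?_
  by_contra hμ0
  have := ContinuousLinearMap.finite_dimensional_eigenspace hSc μ hμ0
  obtain ⟨χ, x, hx, hx0, hxχ⟩ := exists_joint_eigenvector hN
    (Module.End.eigenspace ((Q * ρ : H →L[ℂ] H) : H →ₗ[ℂ] H) μ) hμ fun A hA x hx => by
      rw [Module.End.mem_eigenspace_iff] at hx ⊢
      change (Q * ρ) x = μ • x at hx
      change (Q * ρ) (A x) = μ • A x
      rw [← mul_apply_eq_comp, ← hSN A hA, mul_apply_eq_comp, hx, map_smul]
  have hx1 : (Q * ρ) x = μ • x := Module.End.mem_eigenspace_iff.mp hx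
  have hx2 : x ∈ (eigenSpan N)ᗮ := by
    rw [← inv_smul_smul₀ hμ0 x, ← hx1]
    exact Submodule.smul_mem _ _ (Submodule.starProjection_apply_mem _ _)
  exact hx0 (inner_self_eq_zero.mp
    ((Submodule.mem_orthogonal _ _).mp hx2 x (jointEigenspace_le_eigenSpan χ hxχ)))

/-- The bicommutant of `N` acts as scalars on each joint eigenspace, since it commutes with the
rank one operators there. -/
theorem exists_smul_of_mem_centralizer_centralizer {B : H →L[ℂ] H}
    (hB : B ∈ Set.centralizer (Set.centralizer (N : Set (H →L[ℂ] H)))) (χ : N → ℂ) :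
    ∃ c : ℂ, ∀ x ∈ jointEigenspace N χ, B x = c • x := by
  by_cases hbot : jointEigenspace N χ = ⊥
  · exact ⟨0, fun x hx => by rw [hbot, Submodule.mem_bot] at hx; simp [hx]⟩
  obtain ⟨v, hv, hv0⟩ := Submodule.exists_mem_ne_zero_of_ne_bot hbot
  refine ⟨(⟪v, v⟫_ℂ)⁻¹ * ⟪v, B v⟫_ℂ, fun x hx => ?_⟩
  have hr : InnerProductSpace.rankOne ℂ x v ∈ Set.centralizer (N : Set (H →L[ℂ] H)) := by
    intro A hA
    ext z
    have h1 := mem_jointEigenspace.mp hx ⟨A, hA⟩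
    have h2 := star_apply_of_mem_jointEigenspace hv ⟨A, hA⟩
    dsimp only at h1 h2
    rw [mul_apply_eq_comp, mul_apply_eq_comp, InnerProductSpace.rankOne_apply,
      InnerProductSpace.rankOne_apply, map_smul, h1, ← ContinuousLinearMap.adjoint_inner_left,
      ← ContinuousLinearMap.star_eq_adjoint, h2, inner_smul_left, Complex.conj_conj, smul_smul,
      mul_comm]
  have h := congrArg (fun S => S v) (hB _ hr)
  simp only [mul_apply_eq_comp, InnerProductSpace.rankOne_apply, map_smul] at h
  rw [mul_smul, h, inv_smul_smul₀ (inner_self_ne_zero.mpr hv0)]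

/-! ### The atoms of the bicommutant -/

/-- The bicommutant of a unital `*`-algebra of operators, as a von Neumann algebra. -/
def bicommutant (N : StarSubalgebra ℂ (H →L[ℂ] H)) : VonNeumannAlgebra H where
  toStarSubalgebra := StarSubalgebra.centralizer ℂ
    (StarSubalgebra.centralizer ℂ (N : Set (H →L[ℂ] H)) : Set (H →L[ℂ] H))
  centralizer_centralizer' := by
    change Set.centralizer (Set.centralizer (StarSubalgebra.centralizer ℂ
      (StarSubalgebra.centralizer ℂ (N : Set (H →L[ℂ] H)) : Set (H →L[ℂ] H)) : Set (H →L[ℂ] H))) =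
      (StarSubalgebra.centralizer ℂ
      (StarSubalgebra.centralizer ℂ (N : Set (H →L[ℂ] H)) : Set (H →L[ℂ] H)) : Set (H →L[ℂ] H))
    rw [StarSubalgebra.coe_centralizer_centralizer, Set.centralizer_centralizer_centralizer]

theorem coe_bicommutant (N : StarSubalgebra ℂ (H →L[ℂ] H)) :
    (bicommutant N : Set (H →L[ℂ] H))
      = Set.centralizer (Set.centralizer (N : Set (H →L[ℂ] H))) := by
  change (StarSubalgebra.centralizer ℂ
      (StarSubalgebra.centralizer ℂ (N : Set (H →L[ℂ] H)) : Set (H →L[ℂ] H)) : Set (H →L[ℂ] H)) = _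
  rw [StarSubalgebra.coe_centralizer_centralizer, StarMemClass.star_coe_eq, Set.union_self]

theorem isMinimalProjection_jointEigenspace {χ : N → ℂ} (hχ : jointEigenspace N χ ≠ ⊥) :
    IsMinimalProjection (bicommutant N) (jointEigenspace N χ).starProjection where
  mem := by
    rw [← SetLike.mem_coe, coe_bicommutant]
    exact starProjection_mem_centralizer_centralizer fun T hT x => apply_mem_jointEigenspace hT
  isStarProjection := isStarProjection_starProjection
  ne_zero h := by
    obtain ⟨v, hv, hv0⟩ := Submodule.exists_mem_ne_zero_of_ne_bot hχ
    rw [← Submodule.starProjection_eq_self_iff.mpr hv, h] at hv0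
    exact hv0 rfl
  minimal Q hQ hQp hle := by
    rw [← SetLike.mem_coe, coe_bicommutant] at hQ
    obtain ⟨c, hc⟩ := exists_smul_of_mem_centralizer_centralizer hQ χ
    set P := (jointEigenspace N χ).starProjection with hP
    have hQP : Q * P = Q := (hQp.le_iff_mul_eq_left isStarProjection_starProjection).mp hle
    have hQc : Q = c • P := by
      ext x
      rw [← hQP, mul_apply_eq_comp, hc _ (Submodule.starProjection_apply_mem _ _)]
      rfl
    obtain ⟨v, hv, hv0⟩ := Submodule.exists_mem_ne_zero_of_ne_bot hχ
    have h1 : c • c • v = c • v := by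
      rw [← hc v hv, ← map_smul, ← hc v hv, ← mul_apply_eq_comp, hQp.isIdempotentElem.eq]
    rw [smul_smul] at h1
    have h2 : c * c = c := smul_left_injective ℂ hv0 h1
    rcases IsIdempotentElem.iff_eq_zero_or_one.mp h2 with h | h
    · exact Or.inl (by rw [hQc, h, zero_smul])
    · exact Or.inr (by rw [hQc, h, one_smul])

/-- If the joint eigenvectors of `N` span a dense subspace, then the projections onto the joint
eigenspaces exhibit the bicommutant of `N` as completely atomic. -/
theorem isCompletelyAtomic_bicommutant [TopologicalSpace.SeparableSpace H]
    (hN : eigenSpan N = ⊤) : IsCompletelyAtomic (bicommutant N) := by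
  let X := {χ : N → ℂ // jointEigenspace N χ ≠ ⊥}
  have hX : ∀ χ : X, ∃ v ∈ jointEigenspace N χ.1, ‖v‖ = 1 := by
    intro χ
    obtain ⟨v, hv, hv0⟩ := Submodule.exists_mem_ne_zero_of_ne_bot χ.2
    exact ⟨((‖v‖⁻¹ : ℝ) : ℂ) • v, Submodule.smul_mem _ _ hv, by
      rw [norm_smul]; simp [hv0]⟩
  choose v hv hv1 using hX
  have : Countable X := Orthonormal.countable (v := v) ⟨hv1, fun χ χ' h =>
    inner_eq_zero_of_mem_jointEigenspace (fun h' => h (Subtype.ext h')) (hv χ) (hv χ')⟩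
  obtain ⟨f, hf⟩ := Countable.exists_injective_nat X
  -- the index type has to live in `Type`, so that the characters are numbered
  let e : X ≃ Set.range f := Equiv.ofInjective f hf
  let F : Set.range f → Submodule ℂ H := fun i => jointEigenspace N (e.symm i).1
  have hF : ∀ i j, i ≠ j → ∀ x ∈ F i, ∀ y ∈ F j, ⟪x, y⟫_ℂ = 0 := fun i j hij x hx y hy =>
    inner_eq_zero_of_mem_jointEigenspace
      (fun h => hij (e.symm.injective (Subtype.ext h))) hx hy
  have hFc : ∀ i, CompleteSpace (F i) := fun i =>
    inferInstanceAs (CompleteSpace (jointEigenspace N (e.symm i).1))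
  have htotal : ⊤ ≤ (⨆ i, F i).topologicalClosure := by
    rw [← hN, eigenSpan]
    refine Submodule.topologicalClosure_mono (iSup_le fun χ => ?_)
    by_cases hχ : jointEigenspace N χ = ⊥
    · simp [hχ]
    · refine le_trans (le_of_eq ?_) (le_iSup F (e ⟨χ, hχ⟩))
      simp [F]
  have hsum := IsHilbertSum.mkInternal F
    (fun i j hij x y => hF i j hij x x.2 y y.2) htotal
  let P : Set.range f → H →L[ℂ] H := fun i => (F i).starProjection
  have horth : ∀ i j, i ≠ j → ∀ x ∈ F j, P i x = 0 := fun i j hij x hx =>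
    (Submodule.starProjection_apply_eq_zero_iff _).mpr
      ((Submodule.mem_orthogonal _ _).mpr fun u hu => hF i j hij u hu x hx)
  have hasSum : ∀ x, HasSum (fun i => P i x) x := by
    intro x
    have h1 := hsum.hasSum_linearIsometryEquiv_symm (hsum.linearIsometryEquiv x)
    rw [LinearIsometryEquiv.symm_apply_apply] at h1
    refine hasSum_of_eq h1 fun i => (h1.mapL (P i)).unique ?_
    convert hasSum_single i fun j hj => ?_ using 1
    · exact (Submodule.starProjection_eq_self_iff.mpr
        (hsum.linearIsometryEquiv x i).2).symm
    · exact horth i j hj.symm _ (hsum.linearIsometryEquiv x j).2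
  have hmin : ∀ i, IsMinimalProjection (bicommutant N) (P i) := fun i =>
    isMinimalProjection_jointEigenspace (e.symm i).2
  refine ⟨Set.range f, P, ⟨inferInstance, fun i => isStarProjection_starProjection,
    fun i j hij => ?_, hasSum⟩, hmin, Set.Subset.antisymm ?_ ?_⟩
  · ext x
    exact horth i j hij _ (Submodule.starProjection_apply_mem _ _)
  · intro B hB T hT
    rw [coe_bicommutant] at hB
    ext x
    have h1 := ((hasSum x).mapL B).mapL T
    have h2 := ((hasSum x).mapL T).mapL B
    refine h1.unique (hasSum_of_eq h2 fun i => ?_)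
    obtain ⟨c, hc⟩ := exists_smul_of_mem_centralizer_centralizer hB (e.symm i).1
    have h3 : T (P i x) = P i (T x) := by
      rw [← mul_apply_eq_comp, ← mul_apply_eq_comp, hT _ ⟨i, rfl⟩]
    rw [h3, hc (P i x) (Submodule.starProjection_apply_mem _ _),
      hc (P i (T x)) (Submodule.starProjection_apply_mem _ _), map_smul, h3]
  · rw [← VonNeumannAlgebra.centralizer_centralizer (bicommutant N)]
    refine Set.centralizer_subset (Set.centralizer_subset ?_)
    rintro _ ⟨i, rfl⟩
    exact (hmin i).mem

end Joint

/-! ### The density operators of the marginal -/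

section Marginal

variable {H : Type*} [NormedAddCommGroup H] [InnerProductSpace ℂ H] [CompleteSpace H]
  {Φ : Channel (HTensor H H) H} {N : StarSubalgebra ℂ (H →L[ℂ] H)}

/-- The functional `A ↦ ⟪x, Φ (A ⊗ 1) x⟫`. -/
def Channel.marginalFunctional (Φ : Channel (HTensor H H) H) (x : H) : (H →L[ℂ] H) →ₗ[ℂ] ℂ where
  toFun A := ⟪x, Φ.marginal A x⟫_ℂ
  map_add' A B := by rw [Φ.marginal_add, add_apply, inner_add_right]
  map_smul' c A := by
    rw [Φ.marginal_smul, smul_apply, inner_smul_right, RingHom.id_apply, smul_eq_mul]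

theorem Channel.marginalFunctional_apply (Φ : Channel (HTensor H H) H) (x : H) (A : H →L[ℂ] H) :
    Φ.marginalFunctional x A = ⟪x, Φ.marginal A x⟫_ℂ := rfl

theorem Channel.marginalFunctional_star (Φ : Channel (HTensor H H) H) (x : H) (A : H →L[ℂ] H) :
    Φ.marginalFunctional x (star A) = starRingEnd ℂ (Φ.marginalFunctional x A) := by
  rw [Φ.marginalFunctional_apply, Φ.marginal_star, ContinuousLinearMap.star_eq_adjoint,
    ContinuousLinearMap.adjoint_inner_right, Φ.marginalFunctional_apply, inner_conj_symm]

theorem Channel.continuous_marginalFunctional [TopologicalSpace.SeparableSpace H]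
    (Φ : Channel (HTensor H H) H) (x : H) :
    @Continuous _ _ (ultraweakTopology H) inferInstance (Φ.marginalFunctional x) := by
  let _ := ultraweakTopology H
  let _ := ultraweakTopology (HTensor H H)
  exact (continuous_inner_apply x x).comp (Φ.normal.comp continuous_opTensor_one)

/-- The marginal fixes the ultraweak closure of an algebra of fixed points, by normality. -/
theorem inner_marginal_eq_of_mem_ultraweakClosure [TopologicalSpace.SeparableSpace H]
    (hN : (N : Set (H →L[ℂ] H)) ⊆ Function.fixedPoints Φ.marginal) {A : H →L[ℂ] H}
    (hA : A ∈ ultraweakClosure (N : Set (H →L[ℂ] H))) (x : H) :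
    Φ.marginalFunctional x A = ⟪x, A x⟫_ℂ := by
  let _ := ultraweakTopology H
  refine closure_minimal (s := (N : Set (H →L[ℂ] H)))
    (t := {A | Φ.marginalFunctional x A = ⟪x, A x⟫_ℂ}) (fun B hB => ?_)
    (isClosed_eq (Φ.continuous_marginalFunctional x) (continuous_inner_apply x x)) hA
  have h : Φ.marginal B = B := hN hB
  change ⟪x, Φ.marginal B x⟫_ℂ = _
  rw [h]

variable {κ : Type*} {b : HilbertBasis κ ℂ H} {x : H} {ρ : H →L[ℂ] H}

/-- The functional is hermitian because `Φ` is positive. -/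
theorem isSelfAdjoint_of_isRepresentedBy (h : IsRepresentedBy b (Φ.marginalFunctional x) ρ) :
    IsSelfAdjoint ρ := by
  rw [ContinuousLinearMap.isSelfAdjoint_iff_isSymmetric]
  intro u v
  change ⟪ρ u, v⟫_ℂ = ⟪u, ρ v⟫_ℂ
  rw [← inner_conj_symm, ← h.apply_rankOne, ← h.apply_rankOne, ← Φ.marginalFunctional_star,
    ContinuousLinearMap.star_eq_adjoint, InnerProductSpace.adjoint_rankOne]

/-- The identity `tr (ρ A X) = tr (ρ X A)`, tested on the operators `X` of rank one. -/
theorem mem_centralizer_of_isRepresentedBy (hΦ : Φ.IsSymmetric)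
    (hN : (N : Set (H →L[ℂ] H)) ⊆ Function.fixedPoints Φ.marginal)
    (h : IsRepresentedBy b (Φ.marginalFunctional x) ρ) :
    ρ ∈ Set.centralizer (N : Set (H →L[ℂ] H)) := by
  intro A hA
  refine ContinuousLinearMap.ext fun u => ext_inner_left ℂ fun v => ?_
  rw [mul_apply_eq_comp, mul_apply_eq_comp, ← ContinuousLinearMap.adjoint_inner_left,
    ← h.apply_rankOne, ← h.apply_rankOne, ← InnerProductSpace.rankOne_comp,
    ← InnerProductSpace.comp_rankOne, Φ.marginalFunctional_apply, Φ.marginalFunctional_apply]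
  exact congrArg (fun S : H →L[ℂ] H => ⟪x, S x⟫_ℂ)
    (marginal_mul_comm hΦ hN hA (InnerProductSpace.rankOne ℂ u v)).symm

end Marginal

end Broadcast

end

open Broadcast in
theorem mainTheorem8 {H : Type*} [NormedAddCommGroup H] [InnerProductSpace ℂ H] [CompleteSpace H]
    [TopologicalSpace.SeparableSpace H]
    (Φ : Broadcast.Channel (Broadcast.HTensor H H) H) (hΦ : Φ.IsSymmetric)
    (N : StarSubalgebra ℂ (H →L[ℂ] H))
    (hN : (N : Set (H →L[ℂ] H)) ⊆ Function.fixedPoints Φ.marginal) :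
    ∃ M : VonNeumannAlgebra H,
      (M : Set (H →L[ℂ] H)) = Broadcast.ultraweakClosure (N : Set (H →L[ℂ] H)) ∧
        Broadcast.IsCompletelyAtomic M := by
  refine ⟨bicommutant N, ?_, isCompletelyAtomic_bicommutant ?_⟩
  · rw [coe_bicommutant, ultraweakClosure_eq_centralizer_centralizer]
  have hcomm : ∀ A ∈ N, ∀ B ∈ N, A * B = B * A := fun A hA B hB => by
    have h := commute_marginal hΦ hN hA B
    rwa [show Φ.marginal B = B from hN hB] at h
  -- the projection onto the complement of the joint eigenvectors has zero quadratic form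
  have hQmem := starProjection_eigenSpan_orthogonal_mem (N := N)
  rw [← ultraweakClosure_eq_centralizer_centralizer] at hQmem
  obtain ⟨κ, b, -⟩ := exists_hilbertBasis ℂ H
  have hQ : (((eigenSpan N)ᗮ.starProjection : H →L[ℂ] H) : H →ₗ[ℂ] H) = 0 := by
    rw [← inner_map_self_eq_zero]
    intro x
    obtain ⟨ρ, hρ⟩ := exists_isRepresentedBy b (Φ.marginalFunctional x)
      (Φ.continuous_marginalFunctional x)
    have h0 := starProjection_mul_eq_zero hcomm hρ.isCompactOperator
      (isSelfAdjoint_of_isRepresentedBy hρ) (mem_centralizer_of_isRepresentedBy hΦ hN hρ)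
    have h1 := inner_marginal_eq_of_mem_ultraweakClosure hN hQmem x
    rw [hρ.apply_eq_zero h0] at h1
    rw [← inner_conj_symm]
    exact (congrArg (starRingEnd ℂ) h1.symm).trans (map_zero _)
  rw [← Submodule.orthogonal_eq_bot_iff, Submodule.eq_bot_iff]
  intro x hx
  rw [← Submodule.starProjection_eq_self_iff.mpr hx]
  exact congrArg (fun T : H →ₗ[ℂ] H => T x) hQ
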